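/- **Theorem (An analytical Lieb–Sokal lemma).** A polynomial $p\in\mathbb{R}[z_1,\dots,z_n]$ is *real stable* if $p(z)\neq 0$ for all $z\in\mathbb{C}^n$ with $\operatorname{Im} z_i>0$ for every $i$, and *multiaffine* if it has degree at most $1$ in each variable. A point $\mathbf{a}\in\mathbb{R}^n$ *lies above the roots* of $p$ if $p(\mathbf{a}+\mathbf{t})\neq 0$ for all $\mathbf{t}\in\mathbb{R}^n$ with all coordinates $t_i\ge 0$. The *flip* of a multiaffine polynomial $q=\sum_{S\subseteq[n]}a_S\prod_{i\in S}z_i$ is $\overline{q}=\sum_{S\subseteq[n]}a_S\prod_{i\in[n]\setminus S}z_i$. Let $p,q\in\mathbb{R}[z_1,\dots,z_n]$ be multiaffine real stable polynomials, and let $r=q(\partial)p:=q(\partial_1,\dots,\partial_n)p$. Assume that $r$ is not identically zero. Let $\mathbf{a}$ lie above the roots of $p$, let $\mathbf{b}$ lie above the roots of $\overline{q}$, and put $$\varphi_i=\frac{\partial_i p}{p}(\mathbf{a})+\frac{\partial_i\overline{q}}{\overline{q}}(\mathbf{b}),\qquad i\in[n].$$ Then $\varphi_i>0$ for every $i$,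 and the point $$\mathbf{c}=\mathbf{a}+\mathbf{b}-\left(\frac1{\varphi_1},\dots,\frac1{\varphi_n}\right)$$ lies above the roots of $r$. -/

import Mathlib

open MvPolynomial

noncomputable section

/-- A polynomial is multiaffine if it has degree at most one in each variable. -/
def IsMultiaffine {n : ℕ} (p : MvPolynomial (Fin n) ℝ) : Prop :=
  ∀ i, p.degreeOf i ≤ 1

/-- A real polynomial is real stable if it does not vanish when all the variables lie in the
open upper half plane. (In particular the zero polynomial is not real stable.) -/
def IsRealStable {n : ℕ} (p : MvPolynomial (Fin n) ℝ) : Prop :=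
  ∀ z : Fin n → ℂ, (∀ i, 0 < (z i).im) → aeval z p ≠ 0

/-- The point `a` lies above the roots of `p` if `p` does not vanish on `a + t`, for all `t` in
the closed nonnegative orthant. -/
def LiesAboveRoots {n : ℕ} (a : Fin n → ℝ) (p : MvPolynomial (Fin n) ℝ) : Prop :=
  ∀ t : Fin n → ℝ, (∀ i, 0 ≤ t i) → eval (a + t) p ≠ 0

/-- The flip `∑ S, a_S z ^ ([n] \ S)` of a multiaffine polynomial `q = ∑ S, a_S z ^ S`. -/
def flipPoly {n : ℕ} (q : MvPolynomial (Fin n) ℝ) : MvPolynomial (Fin n) ℝ :=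
  ∑ S : Finset (Fin n), C (q.coeff (∑ i ∈ S, Finsupp.single i 1)) * ∏ i ∈ Sᶜ, X i

/-- The operator `∂ ^ m = ∂₁ ^ m₁ ∘ ⋯ ∘ ∂ₙ ^ mₙ` on polynomials. -/
def partialPow {n : ℕ} (m : Fin n →₀ ℕ) : Module.End ℝ (MvPolynomial (Fin n) ℝ) :=
  ((List.finRange n).map fun i =>
    ((pderiv i).toLinearMap : Module.End ℝ (MvPolynomial (Fin n) ℝ)) ^ m i).prod

/-- The polynomial `q(∂) p = q(∂₁, …, ∂ₙ) p`. -/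
def applyDiff {n : ℕ} (q p : MvPolynomial (Fin n) ℝ) : MvPolynomial (Fin n) ℝ :=
  ∑ m ∈ q.support, q.coeff m • partialPow m p

/-- The logarithmic potential `(∂ᵢ p / p)(a)`. -/
def logPotential {n : ℕ} (p : MvPolynomial (Fin n) ℝ) (i : Fin n) (a : Fin n → ℝ) : ℝ :=
  eval a (pderiv i p) / eval a p

end

/-!
Write `r = q(∂) p`. Applying `∏ᵢ (∂/∂xᵢ + ∂/∂yᵢ)` to `p(x) q̄(y)`, with `q̄` the flip of `q`, gives
`r(x + y)`, so it suffices to follow a point above the roots of a stable multiaffine polynomial `F`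
through one operator `∂ₓ + ∂ᵧ` at a time. Let `G = ∂ₓF + ∂ᵧF`, let `φᵤ = ∂ᵤF / F` be the potentials
of `F`, and let `a` be above the roots of `F`. The strong Rayleigh inequalities
`F · ∂ᵢ∂ⱼF ≤ ∂ᵢF · ∂ⱼF` of `F` make the potentials decrease above `a`, and show that the point
`a - s eₓ` with `s = 1 / (φₓ(a) + φᵧ(a))` is above the roots of `G`. Moreover the potentials of `G`
at `a - s eₓ` are at most those of `F` at `a`: this follows from the Rayleigh inequalities of `F`
for the pairs `(x, u)` and `(y, u)` at the points `a`, `a - s eᵧ` and `a - s eₓ`. Hence the bounds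
on the potentials persist, and the steps can be iterated.
-/

open Set ComplexConjugate

namespace LiebSokal

section Multiaffine

variable {σ R : Type*}

theorem mem_restrictDegree_iff_degreeOf_le [CommSemiring R] {F : MvPolynomial σ R} {d : ℕ} :
    F ∈ restrictDegree σ R d ↔ ∀ i, F.degreeOf i ≤ d := by
  simp only [mem_restrictDegree, degreeOf_le_iff]
  exact ⟨fun h i m hm => h m hm i, fun h m hm i => h i m hm⟩

theorem pderiv_mem_restrictDegree [CommSemiring R] {F : MvPolynomial σ R} {d : ℕ}
    (hF : F ∈ restrictDegree σ R d) (i : σ) : pderiv i F ∈ restrictDegree σ R d := by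
  rw [mem_restrictDegree] at hF ⊢
  intro m hm j
  rw [mem_support_iff, coeff_pderiv] at hm
  have hmi := hF _ (mem_support_iff.2 (left_ne_zero_of_mul hm)) j
  rw [Finsupp.add_apply] at hmi
  omega

theorem pderiv_pderiv_self_eq_zero [CommSemiring R] {F : MvPolynomial σ R}
    (hF : F ∈ restrictDegree σ R 1) (i : σ) : pderiv i (pderiv i F) = 0 := by
  ext m
  rw [coeff_pderiv, coeff_pderiv, coeff_zero, mul_assoc]
  refine mul_eq_zero_of_left (notMem_support_iff.1 fun hm => ?_) _
  have := (mem_restrictDegree σ F 1).1 hF _ hm i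
  simp at this

theorem pderiv_comm [CommRing R] (i j : σ) (F : MvPolynomial σ R) :
    pderiv i (pderiv j F) = pderiv j (pderiv i F) := by
  classical
  have hcomm : ⁅pderiv i, pderiv j⁆ = (0 : Derivation R (MvPolynomial σ R) _) :=
    derivation_ext fun k => by
      rw [Derivation.commutator_apply, pderiv_X, pderiv_X, Pi.single_apply, Pi.single_apply]
      split_ifs <;> simp
  exact sub_eq_zero.1 (DFunLike.congr_fun hcomm F)

theorem aeval_add_single [DecidableEq σ] {A : Type*} [CommRing R] [CommRing A] [Algebra R A]
    {F : MvPolynomial σ R} (hF : F ∈ restrictDegree σ R 1) (z : σ → A) (i : σ) (w : A) :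
    aeval (z + Pi.single i w) F = aeval z F + w * aeval z (pderiv i F) := by
  rw [restrictDegree, restrictSupport_eq_span] at hF
  induction hF using Submodule.span_induction with
  | zero => simp
  | add F G _ _ hF hG => simp only [map_add, hF, hG]; ring
  | smul c F _ hF => simp only [map_smul, Derivation.map_smul, hF, smul_add, mul_smul_comm]
  | mem _ hm =>
    obtain ⟨m, hm, rfl⟩ := hm
    have hsplit (k : σ →₀ ℕ) (v : σ → A) :
        k.prod (fun j e => v j ^ e) = v i ^ k i * (k.erase i).prod fun j e => v j ^ e :=
      (Finsupp.mul_prod_erase' k i _ fun j => pow_zero (v j)).symm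
    have hrest : ((m.erase i).prod fun j e => (z + Pi.single i w : σ → A) j ^ e) =
        (m.erase i).prod fun j e => z j ^ e :=
      Finsupp.prod_congr fun j hj => by
        have hji : j ≠ i := by rintro rfl; simp at hj
        simp [hji]
    have herase : (m - Finsupp.single i 1).erase i = m.erase i := by
      ext j; rcases eq_or_ne j i with rfl | hj <;> simp [*]
    simp only [pderiv_monomial, aeval_monomial]
    rw [hsplit m, hsplit m, hsplit (m - _), hrest, herase]
    rcases Nat.le_one_iff_eq_zero_or_eq_one.1 (hm i) with h | h <;> simp [h, add_mul]

theorem eval_add_single [DecidableEq σ] [CommRing R] {F : MvPolynomial σ R}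
    (hF : F ∈ restrictDegree σ R 1) (v : σ → R) (i : σ) (t : R) :
    eval (v + Pi.single i t) F = eval v F + t * eval v (pderiv i F) := by
  simpa [coe_aeval_eq_eval] using aeval_add_single hF v i t

theorem eval_sub_single [DecidableEq σ] [CommRing R] {F : MvPolynomial σ R}
    (hF : F ∈ restrictDegree σ R 1) (v : σ → R) (i : σ) (t : R) :
    eval (v - Pi.single i t) F = eval v F - t * eval v (pderiv i F) := by
  rw [sub_eq_add_neg, ← Pi.single_neg, eval_add_single hF, neg_mul, ← sub_eq_add_neg]

end Multiaffine

section Stable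

variable {σ R : Type*} [CommRing R] [Algebra R ℂ]

/-- The set of points of `ℂ ^ σ` all of whose coordinates have positive imaginary part. -/
def upperHalfSpace (σ : Type*) : Set (σ → ℂ) :=
  {z | ∀ i, 0 < (z i).im}

/-- Stability for arbitrary variables and coefficients: nonvanishing on the upper half space. For
real polynomials in `Fin n` variables it unfolds to `IsRealStable`; the general version is needed
for polynomials in the two groups of variables `Fin n ⊕ Fin n`. -/
def IsStable (F : MvPolynomial σ R) : Prop :=
  ∀ z ∈ upperHalfSpace σ, aeval z F ≠ 0

theorem upperHalfSpace_eq_pi : upperHalfSpace σ = univ.pi fun _ => {w : ℂ | 0 < w.im} := by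
  ext; simp [upperHalfSpace]

theorem closure_upperHalfSpace : closure (upperHalfSpace σ) = {z | ∀ i, 0 ≤ (z i).im} := by
  ext; simp [upperHalfSpace_eq_pi, closure_pi_set]

theorem isPreconnected_upperHalfSpace : IsPreconnected (upperHalfSpace σ) :=
  upperHalfSpace_eq_pi (σ := σ) ▸ isPreconnected_univ_pi fun _ =>
    (convex_halfSpace_im_gt 0).isPreconnected

theorem isOpen_upperHalfSpace [Finite σ] : IsOpen (upperHalfSpace σ) :=
  upperHalfSpace_eq_pi (σ := σ) ▸ isOpen_set_pi finite_univ fun _ _ =>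
    isOpen_lt continuous_const Complex.continuous_im

theorem eq_zero_of_aeval_upperHalfSpace_eq_zero [FaithfulSMul R ℂ] {G : MvPolynomial σ R}
    (hG : ∀ z ∈ upperHalfSpace σ, aeval z G = 0) : G = 0 := by
  refine map_injective _ (FaithfulSMul.algebraMap_injective R ℂ) ?_
  rw [map_zero]
  have hinf : {w : ℂ | 0 < w.im}.Infinite :=
    infinite_of_injective_forall_mem (f := fun k : ℕ => (k : ℂ) + Complex.I)
      (fun k l h => by simpa using h) fun k => by simp
  refine MvPolynomial.funext_set _ (fun _ => hinf) fun z hz => ?_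
  rw [eval_map, ← aeval_def, map_zero]
  exact hG z fun i => hz i trivial

theorem im_pderiv_div_nonpos {F : MvPolynomial σ R} (hF : F ∈ restrictDegree σ R 1)
    (hs : IsStable F) (i : σ) {z : σ → ℂ} (hz : z ∈ upperHalfSpace σ) :
    (aeval z (pderiv i F) / aeval z F).im ≤ 0 := by
  classical
  by_contra! hpos
  have hderiv : aeval z (pderiv i F) ≠ 0 := by
    intro h
    simp [h] at hpos
  -- Newton's step in the `i`-th coordinate leads to a root, and moves upwards.
  refine hs (z + Pi.single i (-(aeval z (pderiv i F) / aeval z F)⁻¹)) (fun j => ?_) ?_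
  · rcases eq_or_ne j i with rfl | hj
    · have : 0 < (-(aeval z (pderiv j F) / aeval z F)⁻¹).im := by
        rw [Complex.neg_im, Complex.inv_im, neg_div, neg_neg]
        exact div_pos hpos (Complex.normSq_pos.2 fun h => by simp [h] at hpos)
      simpa using add_pos (hz j) this
    · simpa [hj] using hz j
  · rw [aeval_add_single hF, inv_div, neg_mul, div_mul_cancel₀ _ hderiv, add_neg_cancel]

/-- By the open mapping theorem, a nonzero quotient with values in the closed lower half plane does
not attain the boundary value `0`. -/
theorem IsStable.of_im_div_nonpos [Finite σ] [FaithfulSMul R ℂ] {F G : MvPolynomial σ R}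
    (hF : IsStable F) (hG : G ≠ 0)
    (him : ∀ z ∈ upperHalfSpace σ, (aeval z G / aeval z F).im ≤ 0) : IsStable G := by
  have := Fintype.ofFinite σ
  intro z₀ hz₀ h0
  have hanal (H : MvPolynomial σ R) : AnalyticOnNhd ℂ (fun z => aeval z H) (upperHalfSpace σ) :=
    .aeval_mvPolynomial
      (fun i z _ => (ContinuousLinearMap.proj (R := ℂ) (φ := fun _ : σ => ℂ) i).analyticAt z) H
  obtain ⟨w, hconst⟩ | hopen :=
    ((hanal G).div (hanal F) hF).is_constant_or_isOpen isPreconnected_upperHalfSpace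
  · refine hG (eq_zero_of_aeval_upperHalfSpace_eq_zero fun z hz => ?_)
    have hw : aeval z G / aeval z F = aeval z₀ G / aeval z₀ F :=
      (hconst z hz).trans (hconst z₀ hz₀).symm
    rw [h0, zero_div] at hw
    exact (div_eq_zero_iff.1 hw).resolve_right (hF z hz)
  · have hsub : (fun z => aeval z G / aeval z F) '' upperHalfSpace σ ⊆
        interior {w : ℂ | w.im ≤ 0} :=
      interior_maximal (image_subset_iff.2 him)
        (hopen _ Subset.rfl isOpen_upperHalfSpace)
    have := hsub ⟨z₀, hz₀, rfl⟩
    simp [h0] at this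

theorem IsStable.pderiv_add_pderiv [Finite σ] [FaithfulSMul R ℂ] {F : MvPolynomial σ R}
    (hF : F ∈ restrictDegree σ R 1) (hs : IsStable F) {i j : σ}
    (h : pderiv i F + pderiv j F ≠ 0) : IsStable (pderiv i F + pderiv j F) :=
  hs.of_im_div_nonpos h fun z hz => by
    rw [map_add, add_div, Complex.add_im]
    exact add_nonpos (im_pderiv_div_nonpos hF hs i hz) (im_pderiv_div_nonpos hF hs j hz)

end Stable

section Rayleigh

variable {σ : Type*}

/-- The strong Rayleigh inequalities, which for multiaffine real polynomials characterize stability.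
The barrier estimates for a single differentiation step need nothing else about stability. -/
def IsStronglyRayleigh {K : Type*} [CommRing K] [LE K] (F : MvPolynomial σ K) : Prop :=
  ∀ (v : σ → K) (i j : σ),
    eval v F * eval v (pderiv j (pderiv i F)) ≤ eval v (pderiv i F) * eval v (pderiv j F)

theorem aeval_ofReal (F : MvPolynomial σ ℝ) (v : σ → ℝ) :
    aeval (fun i => (v i : ℂ)) F = ((eval v F : ℝ) : ℂ) :=
  aeval_algebraMap_apply ℂ v F

theorem im_pderiv_mul_conj_nonpos {F : MvPolynomial σ ℝ} (hF : F ∈ restrictDegree σ ℝ 1)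
    (hs : IsStable F) (i : σ) {z : σ → ℂ} (hz : ∀ j, 0 ≤ (z j).im) :
    (aeval z (pderiv i F) * conj (aeval z F)).im ≤ 0 := by
  have hcont (G : MvPolynomial σ ℝ) : Continuous fun z : σ → ℂ => aeval z G := by
    simpa only [aeval_def, ← eval_map] using continuous_eval (map (algebraMap ℝ ℂ) G)
  have hclosed : IsClosed {z : σ → ℂ | (aeval z (pderiv i F) * conj (aeval z F)).im ≤ 0} :=
    isClosed_le (Complex.continuous_im.comp
      ((hcont _).mul (Complex.continuous_conj.comp (hcont F)))) continuous_const
  refine closure_minimal (fun z hz => ?_) hclosed (by rwa [closure_upperHalfSpace])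
  have hdiv : aeval z (pderiv i F) * conj (aeval z F) =
      Complex.normSq (aeval z F) * (aeval z (pderiv i F) / aeval z F) := by
    have := hs z hz
    rw [Complex.normSq_eq_conj_mul_self]
    field_simp
  rw [mem_ofPred_eq, hdiv, Complex.im_ofReal_mul]
  exact mul_nonpos_of_nonneg_of_nonpos (Complex.normSq_nonneg _) (im_pderiv_div_nonpos hF hs i hz)

theorem IsStable.isStronglyRayleigh {F : MvPolynomial σ ℝ} (hF : F ∈ restrictDegree σ ℝ 1)
    (hs : IsStable F) : IsStronglyRayleigh F := by
  classical
  intro v i j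
  have him := im_pderiv_mul_conj_nonpos hF hs i
    (z := (fun k => (v k : ℂ)) + Pi.single j Complex.I) fun k => by
      rcases eq_or_ne k j with rfl | hk <;> simp [*]
  rw [aeval_add_single hF, aeval_add_single (pderiv_mem_restrictDegree hF i)] at him
  simp only [aeval_ofReal] at him
  simp at him
  linarith

end Rayleigh

section Barrier

/-- `LiesAboveRoots` for arbitrary variables and coefficients, phrased in terms of the points
`v = a + t` of the closed orthant with vertex `a`. -/
def IsAboveRoots {σ K : Type*} [CommSemiring K] [LE K] (a : σ → K) (F : MvPolynomial σ K) : Prop :=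
  ∀ v, a ≤ v → eval v F ≠ 0

/-- The logarithmic derivative `(∂ᵢF / F)(v)`, that is `logPotential` for arbitrary variables and
coefficients. Like there, the value at a root of `F` is the junk value `0`. -/
noncomputable def potential {σ K : Type*} [Field K] (F : MvPolynomial σ K) (i : σ) (v : σ → K) :
    K :=
  eval v (pderiv i F) / eval v F

theorem potential_add_single {σ K : Type*} [DecidableEq σ] [Field K] {F : MvPolynomial σ K}
    (hF : F ∈ restrictDegree σ K 1) {v : σ → K} (hv : eval v F ≠ 0) (i j : σ) (t : K) :
    potential F i (v + Pi.single j t) =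
      (potential F i v + t * (eval v (pderiv j (pderiv i F)) / eval v F)) /
        (1 + t * potential F j v) := by
  rw [potential, eval_add_single hF, eval_add_single (pderiv_mem_restrictDegree hF i), potential,
    potential, ← mul_div_assoc, ← mul_div_assoc, ← add_div, one_add_div hv,
    div_div_div_cancel_right₀ hv]

variable {σ K : Type*} [Field K] [LinearOrder K] [IsStrictOrderedRing K]
  {F : MvPolynomial σ K} {a v : σ → K}

theorem eq_zero_of_eval_Ici_eq_zero (h : ∀ v, a ≤ v → eval v F = 0) : F = 0 :=
  MvPolynomial.funext_set (fun i => Ici (a i)) (fun i => Ici_infinite (a i))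
    fun v hv => by rw [map_zero]; exact h v fun i => hv i trivial

theorem le_add_single [DecidableEq σ] (hv : a ≤ v) (i : σ) {t : K} (ht : 0 ≤ t) :
    a ≤ v + Pi.single i t :=
  hv.trans (le_add_of_nonneg_right (Pi.single_nonneg.2 ht))

theorem antitoneOn_Ici_of_add_single_le [Finite σ] [DecidableEq σ] {f : (σ → K) → K}
    (h : ∀ v, a ≤ v → ∀ i t, 0 ≤ t → f (v + Pi.single i t) ≤ f v) : AntitoneOn f (Ici a) := by
  have := Fintype.ofFinite σ
  intro v hv w _ hvw
  have hpartial (s : Finset σ) :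
      v ≤ v + ∑ i ∈ s, Pi.single i (w i - v i) ∧
        f (v + ∑ i ∈ s, Pi.single i (w i - v i)) ≤ f v := by
    induction s using Finset.induction_on with
    | empty => simp
    | insert i s hi ih =>
      have hnonneg : 0 ≤ w i - v i := sub_nonneg.2 (hvw i)
      rw [Finset.sum_insert hi, add_comm (Pi.single i _), ← add_assoc]
      exact ⟨le_add_single ih.1 i hnonneg, (h _ (hv.trans ih.1) i _ hnonneg).trans ih.2⟩
  have hw : v + ∑ i, Pi.single i (w i - v i) = w := by
    rw [Finset.univ_sum_single fun i => w i - v i]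
    exact add_sub_cancel v w
  exact hw ▸ (hpartial Finset.univ).2

theorem IsAboveRoots.potential_nonneg (hF : F ∈ restrictDegree σ K 1) (h : IsAboveRoots a F)
    (i : σ) (hv : a ≤ v) : 0 ≤ potential F i v := by
  classical
  by_contra! hneg
  have hderiv : eval v (pderiv i F) ≠ 0 := fun h0 => by simp [potential, h0] at hneg
  refine h _ (le_add_single hv i (t := -(potential F i v)⁻¹) ?_) ?_
  · exact neg_nonneg.2 (inv_nonpos.2 hneg.le)
  · rw [eval_add_single hF, potential, inv_div, neg_mul, div_mul_cancel₀ _ hderiv, add_neg_cancel]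

theorem IsAboveRoots.pderiv_pderiv_div_nonneg (hF : F ∈ restrictDegree σ K 1)
    (h : IsAboveRoots a F) (i j : σ) (hv : a ≤ v) :
    0 ≤ eval v (pderiv j (pderiv i F)) / eval v F := by
  classical
  by_contra! hneg
  set ψ := eval v (pderiv j (pderiv i F)) / eval v F with hψ
  have hj := h.potential_nonneg hF j hv
  have ht : 0 ≤ (potential F i v + 1) / -ψ :=
    div_nonneg (add_nonneg (h.potential_nonneg hF i hv) zero_le_one) (neg_nonneg.2 hneg.le)
  have hlate := h.potential_nonneg hF i (le_add_single hv j ht)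
  rw [potential_add_single hF (h v hv), ← hψ, le_div_iff₀ (by positivity), zero_mul,
    div_neg, neg_mul, div_mul_cancel₀ _ hneg.ne] at hlate
  linarith

theorem IsStronglyRayleigh.pderiv_pderiv_div_le (hs : IsStronglyRayleigh F) (i j : σ)
    (hv : eval v F ≠ 0) :
    eval v (pderiv j (pderiv i F)) / eval v F ≤ potential F i v * potential F j v := by
  rw [potential, potential, div_mul_div_comm, ← mul_div_mul_left _ _ hv]
  exact div_le_div_of_nonneg_right (hs v i j) (mul_self_nonneg _)

theorem IsAboveRoots.antitoneOn_potential [Finite σ] (hF : F ∈ restrictDegree σ K 1)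
    (hs : IsStronglyRayleigh F) (h : IsAboveRoots a F) (i : σ) :
    AntitoneOn (potential F i) (Ici a) := by
  classical
  refine antitoneOn_Ici_of_add_single_le fun v hv j t ht => ?_
  have hj := h.potential_nonneg hF j hv
  rw [potential_add_single hF (h v hv), div_le_iff₀ (by positivity), mul_one_add, mul_left_comm]
  gcongr
  exact hs.pderiv_pderiv_div_le i j (h v hv)

end Barrier

section Step

variable {σ K : Type*}

theorem eval_pderiv_add_pderiv_sub_single [DecidableEq σ] [CommRing K] {F : MvPolynomial σ K}
    (hF : F ∈ restrictDegree σ K 1) (v : σ → K) (x y : σ) (s : K) :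
    eval (v - Pi.single x s) (pderiv x F + pderiv y F) =
      eval v (pderiv x F + pderiv y F) - s * eval v (pderiv y (pderiv x F)) := by
  have hG := add_mem (pderiv_mem_restrictDegree hF x) (pderiv_mem_restrictDegree hF y)
  rw [eval_sub_single hG, map_add (pderiv x), pderiv_pderiv_self_eq_zero hF, zero_add, pderiv_comm]

theorem eval_pderiv_add_pderiv_div [Field K] (F : MvPolynomial σ K) (v : σ → K) (x y : σ) :
    eval v (pderiv x F + pderiv y F) / eval v F = potential F x v + potential F y v := by
  rw [map_add, add_div, potential, potential]

theorem pderiv_pderiv_add_pderiv [CommRing K] (F : MvPolynomial σ K) (x y u : σ) :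
    pderiv u (pderiv x F + pderiv y F) = pderiv x (pderiv u F) + pderiv y (pderiv u F) := by
  rw [map_add, pderiv_comm u x, pderiv_comm u y]

/-- The sum of the Rayleigh inequalities for `(x, u)` at `a - s e_y` and for `(y, u)` at
`a - s e_x`. -/
theorem IsStronglyRayleigh.eval_mul_eval_pderiv_sub_single_le [DecidableEq σ] [CommRing K]
    [LinearOrder K] [IsStrictOrderedRing K] {F : MvPolynomial σ K} (hF : F ∈ restrictDegree σ K 1)
    (hs : IsStronglyRayleigh F) {a : σ → K} {x y : σ} {s : K}
    (hsG : s * eval a (pderiv x F + pderiv y F) = eval a F) (u : σ) :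
    eval a F * eval (a - Pi.single x s) (pderiv u (pderiv x F + pderiv y F)) ≤
      eval a (pderiv u F) * eval (a - Pi.single x s) (pderiv x F + pderiv y F) +
        s * (eval a (pderiv y (pderiv x F)) *
          (s * eval a (pderiv u (pderiv x F + pderiv y F)) - eval a (pderiv u F))) := by
  have hu := pderiv_mem_restrictDegree hF u
  have hx := pderiv_mem_restrictDegree hF x
  have hy := pderiv_mem_restrictDegree hF y
  have hrayx := hs (a - Pi.single y s) x u
  have hrayy := hs (a - Pi.single x s) y u
  rw [pderiv_comm u x, eval_sub_single hF, eval_sub_single (pderiv_mem_restrictDegree hu x),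
    eval_sub_single hx, eval_sub_single hu] at hrayx
  rw [pderiv_comm u y, eval_sub_single hF, eval_sub_single (pderiv_mem_restrictDegree hu y),
    eval_sub_single hy, eval_sub_single hu, pderiv_comm x y, pderiv_comm x y F] at hrayy
  rw [pderiv_pderiv_add_pderiv, eval_pderiv_add_pderiv_sub_single hu,
    eval_pderiv_add_pderiv_sub_single hF]
  rw [map_add] at hsG
  simp only [map_add]
  linear_combination hrayx + hrayy - s * eval a (pderiv y (pderiv x (pderiv u F))) * hsG

variable [Field K] [LinearOrder K] [IsStrictOrderedRing K] [Finite σ]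
  {F : MvPolynomial σ K} {a v : σ → K} {x y : σ}

theorem IsAboveRoots.potential_add_potential_pos (hF : F ∈ restrictDegree σ K 1)
    (hs : IsStronglyRayleigh F) (h : IsAboveRoots a F) (hG : pderiv x F + pderiv y F ≠ 0)
    (hv : a ≤ v) : 0 < potential F x v + potential F y v := by
  by_contra! hle
  refine hG (eq_zero_of_eval_Ici_eq_zero (a := v) fun w hw => ?_)
  have haw := hv.trans hw
  have hzero : potential F x w + potential F y w = 0 :=
    le_antisymm
      ((add_le_add (h.antitoneOn_potential hF hs x hv haw hw)
        (h.antitoneOn_potential hF hs y hv haw hw)).trans hle)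
      (add_nonneg (h.potential_nonneg hF x haw) (h.potential_nonneg hF y haw))
  rw [← eval_pderiv_add_pderiv_div] at hzero
  exact (div_eq_zero_iff.1 hzero).resolve_right (h w haw)

theorem IsAboveRoots.pderiv_add_pderiv_sub_single_div_pos [DecidableEq σ]
    (hF : F ∈ restrictDegree σ K 1) (hs : IsStronglyRayleigh F) (h : IsAboveRoots a F)
    (hG : pderiv x F + pderiv y F ≠ 0) {s : K} (hv : a ≤ v)
    (hs1 : s * (potential F x v + potential F y v) ≤ 1) :
    0 < eval (v - Pi.single x s) (pderiv x F + pderiv y F) / eval v F := by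
  rw [eval_pderiv_add_pderiv_sub_single hF, sub_div, eval_pderiv_add_pderiv_div, mul_div_assoc]
  have hγ := h.potential_add_potential_pos hF hs hG hv
  have hψ := hs.pderiv_pderiv_div_le x y (h v hv)
  have hψ0 := h.pderiv_pderiv_div_nonneg hF x y hv
  set ψ := eval v (pderiv y (pderiv x F)) / eval v F
  set γ := potential F x v + potential F y v
  have hψγ : ψ < γ * γ := by
    have hamgm : 4 * potential F x v * potential F y v ≤ γ ^ 2 := four_mul_le_sq_add _ _
    linarith [pow_pos hγ 2]
  refine pos_of_mul_pos_right ?_ hγ.le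
  calc 0 < γ * γ - ψ := sub_pos.2 hψγ
    _ ≤ γ * γ - s * γ * ψ := by gcongr; exact mul_le_of_le_one_left hψ0 hs1
    _ = γ * (γ - s * ψ) := by ring

theorem IsAboveRoots.pderiv_add_pderiv [DecidableEq σ] (hF : F ∈ restrictDegree σ K 1)
    (hs : IsStronglyRayleigh F) (h : IsAboveRoots a F) (hG : pderiv x F + pderiv y F ≠ 0) {s : K}
    (hs0 : 0 ≤ s) (hs1 : s * (potential F x a + potential F y a) ≤ 1) :
    IsAboveRoots (a - Pi.single x s) (pderiv x F + pderiv y F) := by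
  intro v hv h0
  have hav : a ≤ v + Pi.single x s := sub_le_iff_le_add.1 hv
  have hpos := h.pderiv_add_pderiv_sub_single_div_pos hF hs hG hav <|
    hs1.trans' <| mul_le_mul_of_nonneg_left
      (add_le_add (h.antitoneOn_potential hF hs x self_mem_Ici hav hav)
        (h.antitoneOn_potential hF hs y self_mem_Ici hav hav)) hs0
  rw [add_sub_cancel_right, h0, zero_div] at hpos
  exact hpos.false

theorem IsAboveRoots.potential_pderiv_add_pderiv_le_of_mul_eq_one [DecidableEq σ]
    (hF : F ∈ restrictDegree σ K 1) (hs : IsStronglyRayleigh F) (h : IsAboveRoots a F)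
    (hG : pderiv x F + pderiv y F ≠ 0) {s : K}
    (hs1 : s * (potential F x a + potential F y a) = 1) (u : σ) :
    potential (pderiv x F + pderiv y F) u (a - Pi.single x s) ≤ potential F u a := by
  have hA := h a le_rfl
  have hγ := h.potential_add_potential_pos hF hs hG le_rfl
  have hs0 : 0 < s := pos_of_mul_pos_left (hs1 ▸ one_pos) hγ.le
  have hψ := h.pderiv_pderiv_div_nonneg hF x y le_rfl
  have hpos := h.pderiv_add_pderiv_sub_single_div_pos hF hs hG le_rfl hs1.le
  have hsG : s * eval a (pderiv x F + pderiv y F) = eval a F := by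
    rwa [← eval_pderiv_add_pderiv_div, ← mul_div_assoc, div_eq_one_iff_eq hA] at hs1
  have hmixed : eval a (pderiv y (pderiv x F)) *
      (s * eval a (pderiv u (pderiv x F + pderiv y F)) - eval a (pderiv u F)) ≤ 0 := by
    have hrayx := hs a x u
    have hrayy := hs a y u
    have hle : eval a (pderiv x F + pderiv y F) *
        (s * eval a (pderiv u (pderiv x F + pderiv y F)) - eval a (pderiv u F)) ≤ 0 := by
      simp only [map_add] at hsG ⊢
      linear_combination hrayx + hrayy +
        (eval a (pderiv u (pderiv x F)) + eval a (pderiv u (pderiv y F))) * hsG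
    calc eval a (pderiv y (pderiv x F)) * _
        = eval a (pderiv y (pderiv x F)) / eval a F *
            (s * (eval a (pderiv x F + pderiv y F) *
              (s * eval a (pderiv u (pderiv x F + pderiv y F)) - eval a (pderiv u F)))) := by
          rw [← mul_assoc s, hsG, ← mul_assoc, div_mul_cancel₀ _ hA]
      _ ≤ 0 := mul_nonpos_of_nonneg_of_nonpos hψ (mul_nonpos_of_nonneg_of_nonpos hs0.le hle)
  have hsum := hs.eval_mul_eval_pderiv_sub_single_le hF hsG u
  rw [potential, potential, ← div_div_div_cancel_right₀ hA, div_le_iff₀ hpos, div_mul_div_comm,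
    ← mul_div_mul_left _ _ hA]
  refine div_le_div_of_nonneg_right ?_ (mul_self_nonneg _)
  linarith [mul_nonpos_of_nonneg_of_nonpos hs0.le hmixed]

theorem IsAboveRoots.potential_pderiv_add_pderiv_le [DecidableEq σ]
    (hF : F ∈ restrictDegree σ K 1) (hs : IsStronglyRayleigh F) (h : IsAboveRoots a F)
    (hG : pderiv x F + pderiv y F ≠ 0) (hGs : IsStronglyRayleigh (pderiv x F + pderiv y F)) {s : K}
    (hs1 : s * (potential F x a + potential F y a) ≤ 1) (u : σ) :
    potential (pderiv x F + pderiv y F) u (a - Pi.single x s) ≤ potential F u a := by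
  have hγ := h.potential_add_potential_pos hF hs hG le_rfl
  have hmax := inv_mul_cancel₀ hγ.ne'
  have hsγ : s ≤ (potential F x a + potential F y a)⁻¹ := by
    rwa [← one_div, le_div_iff₀ hγ]
  have hle : a - Pi.single x (potential F x a + potential F y a)⁻¹ ≤ a - Pi.single x s :=
    sub_le_sub_left (Pi.single_mono (f := fun _ => K) x hsγ) a
  exact ((h.pderiv_add_pderiv hF hs hG (inv_nonneg.2 hγ.le) hmax.le).antitoneOn_potential
    (add_mem (pderiv_mem_restrictDegree hF x) (pderiv_mem_restrictDegree hF y)) hGs u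
    self_mem_Ici hle hle).trans
    (h.potential_pderiv_add_pderiv_le_of_mul_eq_one hF hs hG hmax u)

end Step

section Iteration

variable {σ ι : Type*} (x y : ι → σ)

/-- The differential operator `∏ (∂_{x i} + ∂_{y i})`, the product being over the entries `i` of a
list. -/
noncomputable def pderivPairs (R : Type*) [CommSemiring R] (l : List ι) :
    Module.End R (MvPolynomial σ R) :=
  (l.map fun i => (pderiv (x i) + pderiv (y i) : Derivation R _ _).toLinearMap).prod

theorem pderivPairs_cons_apply {R : Type*} [CommSemiring R] (i : ι) (l : List ι)
    (F : MvPolynomial σ R) :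
    pderivPairs x y R (i :: l) F =
      pderiv (x i) (pderivPairs x y R l F) + pderiv (y i) (pderivPairs x y R l F) := by
  simp [pderivPairs]

theorem pderivPairs_mem_restrictDegree {R : Type*} [CommSemiring R] {F : MvPolynomial σ R} {d : ℕ}
    (hF : F ∈ restrictDegree σ R d) (l : List ι) :
    pderivPairs x y R l F ∈ restrictDegree σ R d := by
  induction l with
  | nil => simpa [pderivPairs] using hF
  | cons i l ih =>
    rw [pderivPairs_cons_apply]
    exact add_mem (pderiv_mem_restrictDegree ih _) (pderiv_mem_restrictDegree ih _)

theorem pderivPairs_ne_zero_of_cons {R : Type*} [CommSemiring R] {F : MvPolynomial σ R} {i : ι}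
    {l : List ι} (h : pderivPairs x y R (i :: l) F ≠ 0) : pderivPairs x y R l F ≠ 0 := by
  rintro h0
  simp [pderivPairs_cons_apply, h0] at h

theorem IsStable.pderivPairs [Finite σ] {R : Type*} [CommRing R] [Algebra R ℂ] [FaithfulSMul R ℂ]
    {F : MvPolynomial σ R} (hF : F ∈ restrictDegree σ R 1) (hs : IsStable F) (l : List ι)
    (h : pderivPairs x y R l F ≠ 0) : IsStable (pderivPairs x y R l F) := by
  induction l with
  | nil => simpa [LiebSokal.pderivPairs] using hs
  | cons i l ih =>
    rw [pderivPairs_cons_apply] at h ⊢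
    exact (ih (pderivPairs_ne_zero_of_cons x y (by rwa [pderivPairs_cons_apply]))).pderiv_add_pderiv
      (pderivPairs_mem_restrictDegree x y hF l) h

theorem IsAboveRoots.pderivPairs [Finite σ] [DecidableEq σ] {F : MvPolynomial σ ℝ}
    (hF : F ∈ restrictDegree σ ℝ 1) (hs : IsStable F) {a : σ → ℝ} (ha : IsAboveRoots a F)
    {φ : ι → ℝ} (hφ : ∀ i, potential F (x i) a + potential F (y i) a ≤ φ i) (l : List ι)
    (hne : pderivPairs x y ℝ l F ≠ 0) :
    (∀ i ∈ l, 0 < φ i) ∧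
      IsAboveRoots (a - (l.map fun i => Pi.single (x i) (φ i)⁻¹).sum) (pderivPairs x y ℝ l F) ∧
      ∀ u, potential (pderivPairs x y ℝ l F) u (a - (l.map fun i => Pi.single (x i) (φ i)⁻¹).sum) ≤
        potential F u a := by
  induction l with
  | nil => simpa [LiebSokal.pderivPairs] using ha
  | cons i l ih =>
    have hne' := pderivPairs_ne_zero_of_cons x y hne
    obtain ⟨hφl, hal, hpot⟩ := ih hne'
    have hstable := hs.pderivPairs x y hF _ hne
    have hHs := (hs.pderivPairs x y hF l hne').isStronglyRayleigh
      (pderivPairs_mem_restrictDegree x y hF l)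
    have hGs := hstable.isStronglyRayleigh (pderivPairs_mem_restrictDegree x y hF (i :: l))
    have hH := pderivPairs_mem_restrictDegree x y hF l
    rw [pderivPairs_cons_apply] at hne hGs ⊢
    set H := LiebSokal.pderivPairs x y ℝ l F
    set a' := a - (l.map fun i => Pi.single (x i) (φ i)⁻¹).sum
    have ha' : a - ((i :: l).map fun i => Pi.single (x i) (φ i)⁻¹).sum =
        a' - Pi.single (x i) (φ i)⁻¹ := by
      rw [List.map_cons, List.sum_cons, add_comm, ← sub_sub]
    have hle : potential H (x i) a' + potential H (y i) a' ≤ φ i :=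
      (add_le_add (hpot _) (hpot _)).trans (hφ i)
    have hφi := (hal.potential_add_potential_pos hH hHs hne le_rfl).trans_le hle
    have hφ1 := (inv_mul_le_one₀ hφi).2 hle
    rw [ha']
    exact ⟨List.forall_mem_cons.2 ⟨hφi, hφl⟩,
      hal.pderiv_add_pderiv hH hHs hne (inv_nonneg.2 hφi.le) hφ1,
      fun u => (hal.potential_pderiv_add_pderiv_le hH hHs hne hGs hφ1 u).trans (hpot u)⟩

end Iteration

section Derivation

theorem pow_derivation_apply_mul {R A : Type*} [CommSemiring R] [CommSemiring A] [Algebra R A]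
    {D : Derivation R A A} {w : A} (h : D w = 0) (k : ℕ) (u : A) :
    (D.toLinearMap ^ k) (u * w) = (D.toLinearMap ^ k) u * w := by
  induction k with
  | zero => simp
  | succ k ih =>
    rw [pow_succ', Module.End.mul_apply, Module.End.mul_apply, ih]
    simp [h, mul_comm]

theorem prod_map_pow_derivation_apply_prod {ι R A : Type*} [Fintype ι] [DecidableEq ι]
    [CommSemiring R] [CommSemiring A] [Algebra R A] (D : ι → Derivation R A A) (k : ι → ℕ)
    {u v : ι → A} (hu : ∀ i j, j ≠ i → D i (u j) = 0) (hv : ∀ i j, j ≠ i → D i (v j) = 0)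
    (h : ∀ i, ((D i).toLinearMap ^ k i) (u i) = v i) {l : List ι} (hl : l.Nodup) :
    (l.map fun i => (D i).toLinearMap ^ k i).prod (∏ j, u j) =
      ∏ j, if j ∈ l then v j else u j := by
  induction l with
  | nil => simp
  | cons i l ih =>
    rw [List.nodup_cons] at hl
    have hrest : D i (∏ j ∈ Finset.univ.erase i, if j ∈ l then v j else u j) = 0 :=
      Finset.prod_induction _ (fun w => D i w = 0) (fun w w' hw hw' => by simp [hw, hw'])
        (D i).map_one_eq_zero fun j hj => by
          split_ifs
          exacts [hv i j (Finset.ne_of_mem_erase hj), hu i j (Finset.ne_of_mem_erase hj)]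
    rw [List.map_cons, List.prod_cons, Module.End.mul_apply, ih hl.2,
      ← Finset.mul_prod_erase _ _ (Finset.mem_univ i), if_neg hl.1,
      pow_derivation_apply_mul hrest, h, ← Finset.mul_prod_erase _ _ (Finset.mem_univ i),
      if_pos List.mem_cons_self]
    refine congrArg _ (Finset.prod_congr rfl fun j hj => ?_)
    simp only [List.mem_cons, Finset.ne_of_mem_erase hj, false_or]

end Derivation

section DisjointVariables

variable {σ τ : Type*}

/-- The product `p(x) g(y)` of polynomials in disjoint groups of variables. -/
noncomputable def disjointMul {R : Type*} [CommSemiring R] (p : MvPolynomial σ R)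
    (g : MvPolynomial τ R) : MvPolynomial (σ ⊕ τ) R :=
  rename Sum.inl p * rename Sum.inr g

theorem notMem_vars_rename {R : Type*} [CommSemiring R] {f : σ → τ} {i : τ} (hi : i ∉ range f)
    (p : MvPolynomial σ R) : i ∉ (rename f p).vars := fun h =>
  let ⟨j, _, hj⟩ := mem_vars_rename f p h
  hi ⟨j, hj⟩

theorem degreeOf_rename_of_notMem_range {R : Type*} [CommSemiring R] {f : σ → τ} {i : τ}
    (hi : i ∉ range f) (p : MvPolynomial σ R) : (rename f p).degreeOf i = 0 :=
  not_not.1 (mt mem_vars_iff_degreeOf_ne_zero.2 (notMem_vars_rename hi p))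

theorem disjointMul_mem_restrictDegree {R : Type*} [CommSemiring R] {p : MvPolynomial σ R}
    {g : MvPolynomial τ R} {d : ℕ} (hp : p ∈ restrictDegree σ R d)
    (hg : g ∈ restrictDegree τ R d) : disjointMul p g ∈ restrictDegree (σ ⊕ τ) R d := by
  rw [mem_restrictDegree_iff_degreeOf_le] at *
  rintro (i | i) <;> refine (degreeOf_mul_le _ _ _).trans ?_
  · rw [degreeOf_rename_of_injective Sum.inl_injective,
      degreeOf_rename_of_notMem_range (by simp)]
    exact hp i
  · rw [degreeOf_rename_of_injective Sum.inr_injective,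
      degreeOf_rename_of_notMem_range (by simp), zero_add]
    exact hg i

theorem pderiv_inl_disjointMul {R : Type*} [CommSemiring R] (p : MvPolynomial σ R)
    (g : MvPolynomial τ R) (i : σ) :
    pderiv (Sum.inl i) (disjointMul p g) = disjointMul (pderiv i p) g := by
  rw [disjointMul, pderiv_mul, pderiv_rename Sum.inl_injective,
    pderiv_eq_zero_of_notMem_vars (notMem_vars_rename (by simp) g), mul_zero, add_zero, disjointMul]

theorem pderiv_inr_disjointMul {R : Type*} [CommSemiring R] (p : MvPolynomial σ R)
    (g : MvPolynomial τ R) (i : τ) :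
    pderiv (Sum.inr i) (disjointMul p g) = disjointMul p (pderiv i g) := by
  rw [disjointMul, pderiv_mul, pderiv_rename Sum.inr_injective,
    pderiv_eq_zero_of_notMem_vars (notMem_vars_rename (by simp) p), zero_mul, zero_add, disjointMul]

theorem eval_disjointMul {R : Type*} [CommSemiring R] (p : MvPolynomial σ R)
    (g : MvPolynomial τ R) (v : σ ⊕ τ → R) :
    eval v (disjointMul p g) = eval (v ∘ Sum.inl) p * eval (v ∘ Sum.inr) g := by
  rw [disjointMul, map_mul, eval_rename, eval_rename]

theorem IsStable.disjointMul {R : Type*} [CommRing R] [Algebra R ℂ] {p : MvPolynomial σ R}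
    {g : MvPolynomial τ R} (hp : IsStable p) (hg : IsStable g) : IsStable (disjointMul p g) := by
  intro z hz
  rw [LiebSokal.disjointMul, map_mul, aeval_rename, aeval_rename]
  exact mul_ne_zero (hp _ fun i => hz _) (hg _ fun i => hz _)

theorem IsAboveRoots.disjointMul {R : Type*} [CommSemiring R] [NoZeroDivisors R] [LE R]
    {p : MvPolynomial σ R} {g : MvPolynomial τ R} {a : σ → R} {b : τ → R}
    (hp : IsAboveRoots a p) (hg : IsAboveRoots b g) :
    IsAboveRoots (Sum.elim a b) (disjointMul p g) := by
  intro v hv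
  rw [eval_disjointMul]
  exact mul_ne_zero (hp _ fun i => hv (Sum.inl i)) (hg _ fun i => hv (Sum.inr i))

variable {K : Type*} [Field K] {p : MvPolynomial σ K} {g : MvPolynomial τ K} {a : σ → K} {b : τ → K}

theorem potential_inl_disjointMul (hb : eval b g ≠ 0) (i : σ) :
    potential (disjointMul p g) (Sum.inl i) (Sum.elim a b) = potential p i a := by
  rw [potential, pderiv_inl_disjointMul, eval_disjointMul, eval_disjointMul, Sum.elim_comp_inl,
    Sum.elim_comp_inr, mul_div_mul_right _ _ hb, potential]

theorem potential_inr_disjointMul (ha : eval a p ≠ 0) (i : τ) :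
    potential (disjointMul p g) (Sum.inr i) (Sum.elim a b) = potential g i b := by
  rw [potential, pderiv_inr_disjointMul, eval_disjointMul, eval_disjointMul, Sum.elim_comp_inl,
    Sum.elim_comp_inr, mul_div_mul_left _ _ ha, potential]

end DisjointVariables

section SquareFree

variable {σ R : Type*}

theorem support_sum_single_one (S : Finset σ) :
    (∑ i ∈ S, Finsupp.single i 1 : σ →₀ ℕ).support = S := by
  classical
  ext j
  simp [Finsupp.finsetSum_apply, Finsupp.single_apply]

theorem sum_support_single_one {m : σ →₀ ℕ} (hm : ∀ i, m i ≤ 1) :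
    ∑ i ∈ m.support, Finsupp.single i 1 = m := by
  conv_rhs => rw [← m.sum_single]
  refine Finset.sum_congr rfl fun i hi => ?_
  rw [(hm i).antisymm (Nat.one_le_iff_ne_zero.2 (Finsupp.mem_support_iff.1 hi))]

theorem sum_support_eq_sum_finset [Fintype σ] [CommSemiring R] {M : Type*} [AddCommMonoid M]
    {p : MvPolynomial σ R} (hp : p ∈ restrictDegree σ R 1) {f : (σ →₀ ℕ) → M}
    (hf : ∀ m, p.coeff m = 0 → f m = 0) :
    ∑ m ∈ p.support, f m = ∑ S : Finset σ, f (∑ i ∈ S, Finsupp.single i 1) := by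
  rw [mem_restrictDegree] at hp
  have hinv : LeftInvOn (fun S : Finset σ => (∑ i ∈ S, Finsupp.single i 1 : σ →₀ ℕ))
      Finsupp.support p.support := fun m hm => sum_support_single_one (hp m hm)
  refine Finset.sum_of_injOn Finsupp.support hinv.injOn (by simp [MapsTo]) (fun S _ hS => ?_)
    fun m hm => congrArg f (hinv hm).symm
  exact hf _ (notMem_support_iff.1 fun h => hS ⟨_, h, support_sum_single_one S⟩)

theorem monomial_sum_single_one [CommSemiring R] (S : Finset σ) (c : R) :
    monomial (∑ i ∈ S, Finsupp.single i 1) c = c • ∏ i ∈ S, (X i : MvPolynomial σ R) := by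
  rw [smul_eq_C_mul, monomial_sum_index]
  rfl

theorem eq_sum_coeff_smul_prod_X [Fintype σ] [CommSemiring R] {p : MvPolynomial σ R}
    (hp : p ∈ restrictDegree σ R 1) :
    p = ∑ S : Finset σ, p.coeff (∑ i ∈ S, Finsupp.single i 1) • ∏ i ∈ S, X i := by
  conv_lhs => rw [p.as_sum]
  rw [sum_support_eq_sum_finset hp (f := fun m => monomial m (p.coeff m)) fun m hm => by simp [hm]]
  simp only [monomial_sum_single_one]

theorem prod_X_mem_restrictDegree [CommSemiring R] (S : Finset σ) :
    ∏ i ∈ S, X i ∈ restrictDegree σ R 1 := by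
  classical
  rw [← one_smul R (∏ i ∈ S, X i), ← monomial_sum_single_one, mem_restrictDegree]
  intro m hm j
  rw [Finset.mem_singleton.1 (support_monomial_subset hm), Finsupp.finsetSum_apply]
  simp only [Finsupp.single_apply, Finset.sum_ite_eq']
  split_ifs <;> simp

end SquareFree

section Flip

variable {n : ℕ} {p q : MvPolynomial (Fin n) ℝ}

theorem flipPoly_eq_sum (q : MvPolynomial (Fin n) ℝ) :
    flipPoly q = ∑ S : Finset (Fin n), q.coeff (∑ i ∈ S, Finsupp.single i 1) • ∏ i ∈ Sᶜ, X i := by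
  simp only [flipPoly, smul_eq_C_mul]

theorem flipPoly_mem_restrictDegree (q : MvPolynomial (Fin n) ℝ) :
    flipPoly q ∈ restrictDegree (Fin n) ℝ 1 := by
  rw [flipPoly_eq_sum]
  exact sum_mem fun S _ => Submodule.smul_mem _ _ (prod_X_mem_restrictDegree Sᶜ)

theorem aeval_flipPoly {A : Type*} [Field A] [Algebra ℝ A] (hq : q ∈ restrictDegree (Fin n) ℝ 1)
    {z : Fin n → A} (hz : ∀ i, z i ≠ 0) :
    aeval z (flipPoly q) = (∏ i, z i) * aeval (fun i => (z i)⁻¹) q := by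
  rw [flipPoly_eq_sum]
  conv_rhs => rw [eq_sum_coeff_smul_prod_X hq]
  simp only [map_sum, map_smul, map_prod, aeval_X, Finset.mul_sum]
  refine Finset.sum_congr rfl fun S _ => ?_
  have hS : ∏ i ∈ S, z i ≠ 0 := Finset.prod_ne_zero_iff.2 fun i _ => hz i
  rw [mul_smul_comm, ← Finset.prod_mul_prod_compl S z, Finset.prod_inv_distrib, mul_right_comm,
    mul_inv_cancel₀ hS, one_mul]

theorem IsStable.flipPoly (hq : q ∈ restrictDegree (Fin n) ℝ 1) (hs : IsStable q) :
    IsStable (flipPoly q) := by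
  intro z hz
  have hz0 (i) : z i ≠ 0 := fun h => by simpa [h] using hz i
  rw [aeval_flipPoly hq hz0]
  refine mul_ne_zero (Finset.prod_ne_zero_iff.2 fun i _ => hz0 i) fun h0 => ?_
  -- `z ↦ 1 / z` maps the upper half plane to the lower one, so conjugate the root.
  refine hs (fun i => conj (z i)⁻¹) (fun i => ?_) ?_
  · simpa [Complex.inv_im, neg_div] using div_pos (hz i) (Complex.normSq_pos.2 (hz0 i))
  · have hconj := congrArg Complex.conjAe h0
    rwa [map_zero, ← AlgEquiv.coe_toAlgHom, comp_aeval_apply] at hconj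

theorem partialPow_prod_X (S T : Finset (Fin n)) :
    partialPow (∑ i ∈ S, Finsupp.single i 1) (∏ i ∈ T, X i) =
      ∏ i, if i ∈ T then (if i ∈ S then 1 else X i) else (if i ∈ S then 0 else 1) := by
  have hT : ∏ i ∈ T, (X i : MvPolynomial (Fin n) ℝ) = ∏ i, if i ∈ T then X i else 1 := by simp
  rw [partialPow, hT, prod_map_pow_derivation_apply_prod (fun i => pderiv i) _ (v :=
    fun i => if i ∈ T then (if i ∈ S then 1 else X i) else (if i ∈ S then 0 else 1))
    (fun i j hij => ?_) (fun i j hij => ?_) (fun i => ?_) (List.nodup_finRange n)]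
  · simp only [List.mem_finRange, if_true]
  · split_ifs <;> simp [pderiv_X_of_ne hij]
  · split_ifs <;> simp [pderiv_X_of_ne hij]
  · by_cases hS : i ∈ S <;> by_cases hT : i ∈ T <;>
      simp [hS, hT, Finsupp.finsetSum_apply, Finsupp.single_apply]

theorem pderivPairs_disjointMul_prod_X (S T : Finset (Fin n)) :
    pderivPairs Sum.inl Sum.inr ℝ (List.finRange n)
        (disjointMul (∏ i ∈ T, X i) (∏ i ∈ Sᶜ, X i)) =
      ∏ i, if i ∈ T then (if i ∈ S then 1 else X (Sum.inl i) + X (Sum.inr i))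
        else (if i ∈ S then 0 else 1) := by
  have hfactor : disjointMul (∏ i ∈ T, X i) (∏ i ∈ Sᶜ, X i) =
      ∏ i : Fin n, ((if i ∈ T then X (Sum.inl i) else 1) * (if i ∈ Sᶜ then X (Sum.inr i) else 1) :
        MvPolynomial (Fin n ⊕ Fin n) ℝ) := by
    simp only [disjointMul, Finset.prod_mul_distrib, map_prod, rename_X, Finset.prod_ite_mem,
      Finset.univ_inter]
  have hprod := prod_map_pow_derivation_apply_prod
    (fun i : Fin n => (pderiv (Sum.inl i) + pderiv (Sum.inr i) :
      Derivation ℝ (MvPolynomial (Fin n ⊕ Fin n) ℝ) _)) (fun _ => 1)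
    (u := fun i => (if i ∈ T then X (Sum.inl i) else 1) * (if i ∈ Sᶜ then X (Sum.inr i) else 1))
    (v := fun i => if i ∈ T then (if i ∈ S then 1 else X (Sum.inl i) + X (Sum.inr i))
        else (if i ∈ S then 0 else 1))
    (fun i j hij => ?_) (fun i j hij => ?_) (fun i => ?_) (List.nodup_finRange n)
  · simpa only [pow_one, List.mem_finRange, if_true, pderivPairs, hfactor] using hprod
  · split_ifs <;> simp [pderiv_X, hij]
  · split_ifs <;> simp [pderiv_X, hij]
  · by_cases hS : i ∈ S <;> by_cases hT : i ∈ T <;> simp [hS, hT, pderiv_X, add_comm]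

/-- Applying `∏ᵢ (∂/∂xᵢ + ∂/∂yᵢ)` to `p(x) q̄(y)` gives `r(x + y)`, where `r = q(∂) p`. This
reduces the theorem to differential operators of order one. -/
theorem pderivPairs_disjointMul_flipPoly (hp : p ∈ restrictDegree (Fin n) ℝ 1)
    (hq : q ∈ restrictDegree (Fin n) ℝ 1) :
    pderivPairs Sum.inl Sum.inr ℝ (List.finRange n) (disjointMul p (flipPoly q)) =
      aeval (fun i => X (Sum.inl i) + X (Sum.inr i)) (applyDiff q p) := by
  have hmonomial (S T : Finset (Fin n)) :
      pderivPairs Sum.inl Sum.inr ℝ (List.finRange n)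
        (rename Sum.inl (∏ i ∈ T, X i) * rename Sum.inr (∏ i ∈ Sᶜ, X i)) =
      aeval (fun i => X (Sum.inl i) + X (Sum.inr i))
        (partialPow (∑ i ∈ S, Finsupp.single i 1) (∏ i ∈ T, X i) :
          MvPolynomial (Fin n) ℝ) := by
    rw [partialPow_prod_X, ← disjointMul, pderivPairs_disjointMul_prod_X, map_prod]
    refine Finset.prod_congr rfl fun i _ => ?_
    split_ifs <;> simp
  rw [applyDiff, sum_support_eq_sum_finset hq fun m hm => by rw [hm, zero_smul], flipPoly_eq_sum,
    disjointMul]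
  conv_lhs => rw [eq_sum_coeff_smul_prod_X hp]
  conv_rhs => rw [eq_sum_coeff_smul_prod_X hp]
  simp only [map_sum, map_smul, Finset.sum_mul_sum, smul_mul_smul_comm, hmonomial,
    Finset.smul_sum, smul_smul]
  rw [Finset.sum_comm]
  simp only [mul_comm]

end Flip

section AddVariables

variable {σ K : Type*}

theorem aeval_X_inl_add_X_inr_injective [CommSemiring K] :
    Function.Injective
      (aeval fun i => X (Sum.inl i) + X (Sum.inr i) :
        MvPolynomial σ K →ₐ[K] MvPolynomial (σ ⊕ σ) K) := by
  refine Function.LeftInverse.injective (g := aeval (Sum.elim X 0)) fun p => ?_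
  rw [comp_aeval_apply]
  simp

theorem IsAboveRoots.of_aeval_X_inl_add_X_inr [CommRing K] [PartialOrder K] [IsOrderedAddMonoid K]
    {p : MvPolynomial σ K} {a b : σ → K}
    (h : IsAboveRoots (Sum.elim a b) (aeval (fun i => X (Sum.inl i) + X (Sum.inr i)) p)) :
    IsAboveRoots (a + b) p := by
  intro v hv
  have hroots := h (Sum.elim (v - b) b) (Sum.elim_le_elim_iff.2 ⟨le_sub_iff_add_le.2 hv, le_rfl⟩)
  rw [← coe_aeval_eq_eval, RingHom.coe_coe, comp_aeval_apply] at hroots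
  simpa using hroots

theorem elim_sub_sum_map_single {n : ℕ} [AddCommGroup K] (a b s : Fin n → K) :
    Sum.elim a b - ((List.finRange n).map fun i => Pi.single (Sum.inl i) (s i)).sum =
      Sum.elim (a - s) b := by
  rw [← Fin.sum_univ_def]
  ext (i | i) <;> simp [Finset.sum_apply, Pi.single_apply]

theorem isAboveRoots_iff_liesAboveRoots {n : ℕ} {p : MvPolynomial (Fin n) ℝ} {a : Fin n → ℝ} :
    IsAboveRoots a p ↔ LiesAboveRoots a p := by
  refine ⟨fun h t ht => h _ (le_add_of_nonneg_right ht), fun h v hv => ?_⟩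
  simpa using h (v - a) fun i => sub_nonneg.2 (hv i)

end AddVariables

end LiebSokal

open LiebSokal

theorem mainTheorem1 {n : ℕ} (p q : MvPolynomial (Fin n) ℝ)
    (hp : IsMultiaffine p) (hp' : IsRealStable p)
    (hq : IsMultiaffine q) (hq' : IsRealStable q)
    (hr : applyDiff q p ≠ 0)
    (a b : Fin n → ℝ)
    (ha : LiesAboveRoots a p) (hb : LiesAboveRoots b (flipPoly q))
    (φ : Fin n → ℝ)
    (hφ : ∀ i, φ i = logPotential p i a + logPotential (flipPoly q) i b) :
    (∀ i, 0 < φ i) ∧ LiesAboveRoots (fun i => a i + b i - 1 / φ i) (applyDiff q p) := by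
  rw [← isAboveRoots_iff_liesAboveRoots] at ha hb ⊢
  have hpd := mem_restrictDegree_iff_degreeOf_le.2 hp
  have hqd := mem_restrictDegree_iff_degreeOf_le.2 hq
  have hconv := pderivPairs_disjointMul_flipPoly hpd hqd
  have hpotential (i) : potential (disjointMul p (flipPoly q)) (Sum.inl i) (Sum.elim a b) +
      potential (disjointMul p (flipPoly q)) (Sum.inr i) (Sum.elim a b) = φ i := by
    rw [potential_inl_disjointMul (hb b le_rfl), potential_inr_disjointMul (ha a le_rfl), hφ]
    rfl
  obtain ⟨hφpos, hroots, -⟩ := IsAboveRoots.pderivPairs Sum.inl Sum.inr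
    (disjointMul_mem_restrictDegree hpd (flipPoly_mem_restrictDegree q))
    (IsStable.disjointMul hp' (IsStable.flipPoly hqd hq')) (ha.disjointMul hb)
    (fun i => (hpotential i).le) (List.finRange n)
    (hconv ▸ (map_ne_zero_iff _ aeval_X_inl_add_X_inr_injective).2 hr)
  have hpoint : (fun i => a i + b i - 1 / φ i) = (a - fun i => (φ i)⁻¹) + b := by
    ext i
    rw [one_div, Pi.add_apply, Pi.sub_apply, sub_add_eq_add_sub]
  rw [hconv, elim_sub_sum_map_single] at hroots
  exact ⟨fun i => hφpos i (List.mem_finRange i), hpoint ▸ hroots.of_aeval_X_inl_add_X_inr⟩
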